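/- **Theorem (Spectral theorem for symmetric operators).** Let $\mathbb{K}$ be $\mathbb{R}$ or $\mathbb{C}$, let $H$ be a separable infinite-dimensional Hilbert space over $\mathbb{K}$, and let $A:\operatorname{dom}(A)\to H$ be a densely defined symmetric linear operator on $H$ (not assumed to be bounded, closed or self-adjoint), i.e. $\operatorname{dom}(A)$ is a dense linear subspace of $H$ and $\langle Ax,y\rangle=\langle x,Ay\rangle$ for all $x,y\in\operatorname{dom}(A)$. Then there exist - a compact metric space $(\Omega,d)$ with a probability measure $\mu$ on its Borel $\sigma$-algebra, - a Borel measurable function $m:\Omega\to\mathbb{R}$, and - a linear isometry (not necessarily surjective) $U:H\to L_2(\Omega,\mu)=L_2(\Omega,\mu;\mathbb{K})$, such that the multiplication operator $T$ on $L_2(\Omega,\mu)$ given by $Tf=mf$ on its maximal domain $\operatorname{dom}(T)=\{f\in L_2(\Omega,\mu): mf\in L_2(\Omega,\mu)\}$ is densely defined and self-adjoint, and $T\circ U$ extends $U\circ A$: for every $x\in\operatorname{dom}(A)$ one has $Ux\in\operatorname{dom}(T)$ and $T(Ux)=U(Ax)$. -/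

import Mathlib

open MeasureTheory

noncomputable section

/-- The multiplication operator by a real function `m` on `L²(Ω, μ; 𝕜)`, as a partially defined
linear operator with its maximal domain: all `f ∈ L²` such that `m • f` is again in `L²`. -/
def mulOperator (𝕜 : Type*) [RCLike 𝕜] {Ω : Type*} [MeasurableSpace Ω] (μ : Measure Ω)
    (m : Ω → ℝ) : Lp 𝕜 2 μ →ₗ.[𝕜] Lp 𝕜 2 μ where
  domain :=
    { carrier := {f | MemLp (fun ω => (m ω : 𝕜) * f ω) 2 μ}
      add_mem' := fun {f g} hf hg => by
        refine (MemLp.add hf hg).ae_eq ?_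
        filter_upwards [Lp.coeFn_add f g] with ω hω
        simp only [hω, Pi.add_apply, mul_add]
      zero_mem' := by
        refine (MemLp.zero (ε := 𝕜) (p := 2) (μ := μ)).ae_eq ?_
        filter_upwards [Lp.coeFn_zero 𝕜 2 μ] with ω hω
        simp only [hω, Pi.zero_apply, mul_zero]
      smul_mem' := fun c f hf => by
        refine (MemLp.const_smul hf c).ae_eq ?_
        filter_upwards [Lp.coeFn_smul c f] with ω hω
        simp [hω, mul_left_comm] }
  toFun :=
    { toFun := fun f => MemLp.toLp (fun ω => (m ω : 𝕜) * (f : Lp 𝕜 2 μ) ω) f.2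
      map_add' := fun f g => by
        rw [← MemLp.toLp_add]
        refine MemLp.toLp_congr _ _ ?_
        filter_upwards [Lp.coeFn_add (f : Lp 𝕜 2 μ) (g : Lp 𝕜 2 μ)] with ω hω
        simp only [Submodule.coe_add, hω, Pi.add_apply, mul_add]
      map_smul' := fun c f => by
        rw [RingHom.id_apply, ← MemLp.toLp_const_smul]
        refine MemLp.toLp_congr _ _ ?_
        filter_upwards [Lp.coeFn_smul c (f : Lp 𝕜 2 μ)] with ω hω
        simp [hω, mul_left_comm] }

end

/-! ### Unbounded multiplication operators -/

section MulOperator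

variable {𝕜 : Type*} [RCLike 𝕜] {Ω : Type*} [MeasurableSpace Ω] {μ : Measure Ω} {m : Ω → ℝ}

/-! Compress `A` to finite-dimensional subspaces of its domain and pass to a weak limit. Choose `g
j` in the domain with `∑ ‖g j‖² ≤ 1` whose combinations are dense in the graph of `A`. Diagonalizing
the compression to the span of finitely many `g j` gives an atomic probability measure on the
compact `SpectralModel`: an eigenvector `v` with eigenvalue `l` becomes a point with parameter `t =
l / (1 + |l|)` and coordinates proportional to `⟨v, g j⟩`. Writing `g_c` for the combination of the
`g j` with coefficients `c`, and `u_c` for that of the coordinate functions, one has `‖u_c‖ = ‖g_c‖`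
and `‖t u_c - (1 - |t|) u_d‖ ≤ ‖A g_c - g_d‖`. The functions involved are continuous, so both
relations survive a limit of measures. The first makes `g_c ↦ u_c` an isometry `U`; in the second,
letting `g_d` tend to `A g_c` gives `t U x = (1 - |t|) U (A x)`, whence `m = t / (1 - |t|)`. -/

lemma coeFn_mulOperator (f : (mulOperator 𝕜 μ m).domain) :
    mulOperator 𝕜 μ m f =ᵐ[μ] fun ω => (m ω : 𝕜) * (f : Lp 𝕜 2 μ) ω :=
  MemLp.coeFn_toLp (p := 2) f.2

lemma memLp_indicator_mul (hm : Measurable m) {f : Ω → 𝕜} (hf : MemLp f 2 μ) (N : ℕ) :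
    MemLp ({ω | |m ω| ≤ N}.indicator fun ω => (m ω : 𝕜) * f ω) 2 μ := by
  have hS : MeasurableSet {ω | |m ω| ≤ N} := measurableSet_le hm.abs measurable_const
  refine hf.of_le_mul (c := N) ?_ (.of_forall fun ω => ?_)
  · exact ((RCLike.measurable_ofReal.comp hm).aestronglyMeasurable.mul
      hf.aestronglyMeasurable).indicator hS
  · by_cases hω : |m ω| ≤ N
    · rw [Set.indicator_of_mem (by exact hω), norm_mul, RCLike.norm_ofReal]
      gcongr
    · rw [Set.indicator_of_notMem (by exact hω), norm_zero]
      positivity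

/-- Test against `z - m y` cut off to `{|m| ≤ N}`, which lies in the domain because `m` is bounded
there. The case `y = 0` yields density of the domain; the general case identifies the adjoint. -/
lemma ae_eq_mul_of_forall_inner_eq (hm : Measurable m) {y z : Lp 𝕜 2 μ}
    (h : ∀ x : (mulOperator 𝕜 μ m).domain,
      inner 𝕜 z (x : Lp 𝕜 2 μ) = inner 𝕜 y (mulOperator 𝕜 μ m x)) :
    z =ᵐ[μ] fun ω => (m ω : 𝕜) * y ω := by
  have key : ∀ N : ℕ, ∀ᵐ ω ∂μ, |m ω| ≤ N → z ω = (m ω : 𝕜) * y ω := by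
    intro N
    set S : Set Ω := {ω | |m ω| ≤ N}
    have hS : MeasurableSet S := measurableSet_le hm.abs measurable_const
    have hw : MemLp (S.indicator fun ω => z ω - (m ω : 𝕜) * y ω) 2 μ := by
      have := ((Lp.memLp z).indicator hS).sub (memLp_indicator_mul hm (Lp.memLp y) N)
      rwa [← Set.indicator_sub'] at this
    have hmw : MemLp (fun ω => (m ω : 𝕜) * hw.toLp _ ω) 2 μ := by
      refine (memLp_indicator_mul hm (Lp.memLp (hw.toLp _)) N).ae_eq ?_
      filter_upwards [hw.coeFn_toLp] with ω h1
      by_cases hω : ω ∈ S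
      · exact Set.indicator_of_mem hω _
      · rw [Set.indicator_of_notMem hω, h1, Set.indicator_of_notMem hω, mul_zero]
    have h0 := h ⟨hw.toLp _, hmw⟩
    have h1 : inner 𝕜 (hw.toLp _) (hw.toLp _) = (0 : 𝕜) := by
      rw [← sub_eq_zero.mpr h0, L2.inner_def, L2.inner_def, L2.inner_def,
        ← integral_sub (L2.integrable_inner _ _) (L2.integrable_inner _ _)]
      refine integral_congr_ae ?_
      filter_upwards [hw.coeFn_toLp, coeFn_mulOperator ⟨hw.toLp _, hmw⟩] with ω h1 h2
      rw [h2]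
      simp only [h1]
      by_cases hω : ω ∈ S
      · simp only [Set.indicator_of_mem hω, RCLike.inner_apply, map_sub, map_mul,
          RCLike.conj_ofReal]
        ring
      · simp [Set.indicator_of_notMem hω]
    have h2 := (Lp.eq_zero_iff_ae_eq_zero).mp (inner_self_eq_zero.mp h1)
    filter_upwards [hw.coeFn_toLp, h2] with ω h3 h4 hω
    rw [h3, Set.indicator_of_mem (by exact hω)] at h4
    exact sub_eq_zero.mp h4
  filter_upwards [ae_all_iff.mpr key] with ω hω
  obtain ⟨N, hN⟩ := exists_nat_ge |m ω|
  exact hω N hN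

lemma dense_mulOperator_domain (hm : Measurable m) :
    Dense ((mulOperator 𝕜 μ m).domain : Set (Lp 𝕜 2 μ)) := by
  rw [Submodule.dense_iff_topologicalClosure_eq_top, Submodule.topologicalClosure_eq_top_iff,
    Submodule.eq_bot_iff]
  intro z hz
  refine Lp.eq_zero_iff_ae_eq_zero.mpr ?_
  have := ae_eq_mul_of_forall_inner_eq hm (y := 0) (z := z) fun x => by
    rw [inner_zero_left]
    exact Submodule.inner_left_of_mem_orthogonal x.2 hz
  filter_upwards [this, Lp.coeFn_zero 𝕜 2 μ] with ω h1 h2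
  rw [h1, h2, Pi.zero_apply, mul_zero]

lemma isSelfAdjoint_mulOperator (hm : Measurable m) : IsSelfAdjoint (mulOperator 𝕜 μ m) := by
  have hd := dense_mulOperator_domain (𝕜 := 𝕜) (μ := μ) hm
  rw [LinearPMap.isSelfAdjoint_def]
  have hsym : (mulOperator 𝕜 μ m).IsFormalAdjoint (mulOperator 𝕜 μ m) := by
    intro x y
    rw [L2.inner_def, L2.inner_def]
    refine integral_congr_ae ?_
    filter_upwards [coeFn_mulOperator x, coeFn_mulOperator y] with ω h1 h2
    rw [h1, h2]
    simp only [RCLike.inner_apply, map_mul, RCLike.conj_ofReal]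
    ring
  suffices hle : (mulOperator 𝕜 μ m).adjoint ≤ mulOperator 𝕜 μ m from
    le_antisymm hle (hsym.le_adjoint hd)
  refine ⟨fun y hy => ?_, ?_⟩
  · have := ae_eq_mul_of_forall_inner_eq hm (fun x =>
      LinearPMap.adjoint_isFormalAdjoint hd ⟨y, hy⟩ x)
    exact (Lp.memLp _).ae_eq this
  · intro y y' hyy
    have := ae_eq_mul_of_forall_inner_eq hm (fun x =>
      LinearPMap.adjoint_isFormalAdjoint hd y x)
    refine Lp.ext (this.trans ?_)
    rw [hyy]
    exact (coeFn_mulOperator y').symm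

end MulOperator

/-! ### Atomic measures and the compact model space -/

lemma exists_probabilityMeasure_integral_eq_sum {Ω ι : Type*} [TopologicalSpace Ω] [CompactSpace Ω]
    [MeasurableSpace Ω] [BorelSpace Ω] [MeasurableSingletonClass Ω] [Fintype ι] (ω₀ : Ω)
    (ω : ι → Ω) (p : ι → ℝ) (hp : ∀ i, 0 ≤ p i) (hsum : ∑ i, p i ≤ 1) :
    ∃ P : ProbabilityMeasure Ω, ∀ h : C(Ω, ℝ), h ω₀ = 0 →
      ∫ x, h x ∂(P : Measure Ω) = ∑ i, p i * h (ω i) := by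
  set Q : Measure Ω := ∑ i, ENNReal.ofReal (p i) • Measure.dirac (ω i)
  have hQ : Q Set.univ = ENNReal.ofReal (∑ i, p i) := by
    simp [Q, ENNReal.ofReal_sum_of_nonneg fun i _ => hp i]
  -- The missing mass sits at `ω₀`, where the test functions vanish.
  have hprob : IsProbabilityMeasure
      (Q + ENNReal.ofReal (1 - ∑ i, p i) • Measure.dirac ω₀) := by
    constructor
    rw [Measure.add_apply, hQ, Measure.smul_apply, measure_univ, smul_eq_mul, mul_one,
      ← ENNReal.ofReal_add (Finset.sum_nonneg fun i _ => hp i) (by linarith)]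
    simp
  refine ⟨⟨_, hprob⟩, fun h h0 => ?_⟩
  have hint : ∀ (ν : Measure Ω) [IsFiniteMeasure ν], Integrable h ν := fun ν _ =>
    h.continuous.integrable_of_hasCompactSupport (HasCompactSupport.of_compactSpace _)
  have hfin : ∀ (a : ℝ) (x : Ω), IsFiniteMeasure (ENNReal.ofReal a • Measure.dirac x) :=
    fun a x => Measure.smul_finite _ ENNReal.ofReal_ne_top
  rw [ProbabilityMeasure.coe_mk, integral_add_measure (hint _) (hint _),
    integral_finsetSum_measure (fun i _ => hint _)]
  simp [integral_smul_measure, h0, ENNReal.toReal_ofReal (hp _)]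

/-- A compact space carrying the value `t ∈ [-1, 1]` of a bounded transform of a symmetric operator
and countably many scalars of norm at most one. Real and complex scalars are both stored in `ℂ`. -/
abbrev SpectralModel : Type := Set.Icc (-1 : ℝ) 1 × (ℕ → Metric.closedBall (0 : ℂ) 1)

namespace SpectralModel

/-- The bounded spectral parameter. -/
def param : C(SpectralModel, ℝ) := ⟨fun ω => ω.1, by fun_prop⟩

/-- The `j`-th scalar coordinate. -/
noncomputable def coord (𝕜 : Type*) [RCLike 𝕜] (j : ℕ) : C(SpectralModel, 𝕜) :=
  ⟨fun ω => RCLike.map ℂ 𝕜 (ω.2 j), by fun_prop⟩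

variable {𝕜 : Type*} [RCLike 𝕜]

lemma abs_param_le (ω : SpectralModel) : |param ω| ≤ 1 := abs_le.mpr ω.1.2

lemma exists_point (t : ℝ) (ht : |t| ≤ 1) (z : ℕ → 𝕜) (hz : ∀ j, ‖z j‖ ≤ 1) :
    ∃ ω : SpectralModel, param ω = t ∧ ∀ j, coord 𝕜 j ω = z j := by
  have hmap : ∀ a : 𝕜, ‖RCLike.map 𝕜 ℂ a‖ = ‖a‖ := fun a => by
    rw [← sq_eq_sq₀ (norm_nonneg _) (norm_nonneg _), RCLike.norm_sq_eq_def, RCLike.norm_sq_eq_def]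
    simp
  have hinv : ∀ a : 𝕜, RCLike.map ℂ 𝕜 (RCLike.map 𝕜 ℂ a) = a := fun a => by
    apply RCLike.ext <;> simp
  refine ⟨(⟨t, abs_le.mp ht⟩, fun j => ⟨RCLike.map 𝕜 ℂ (z j), ?_⟩), rfl, fun j => hinv _⟩
  rw [mem_closedBall_zero_iff, hmap]
  exact hz j

/-- Finite linear combinations of the coordinates. -/
noncomputable def comb (𝕜 : Type*) [RCLike 𝕜] : (ℕ →₀ 𝕜) →ₗ[𝕜] C(SpectralModel, 𝕜) :=
  Finsupp.linearCombination 𝕜 (coord 𝕜)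

lemma comb_apply (c : ℕ →₀ 𝕜) (ω : SpectralModel) :
    comb 𝕜 c ω = Finsupp.linearCombination 𝕜 (fun j => coord 𝕜 j ω) c := by
  simp [comb, Finsupp.linearCombination_apply, Finsupp.sum]

end SpectralModel

/-! ### Finite-dimensional compressions -/

section Compression

variable {𝕜 : Type*} [RCLike 𝕜] {H : Type*} [NormedAddCommGroup H] [InnerProductSpace 𝕜 H]

lemma exists_orthonormalBasis_compression (A : H →ₗ.[𝕜] H)
    (hsymm : ∀ x y : A.domain, inner 𝕜 (A x) (y : H) = inner 𝕜 (x : H) (A y))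
    (F : Submodule 𝕜 H) [FiniteDimensional 𝕜 F] (hF : F ≤ A.domain) :
    ∃ (n : ℕ) (v : OrthonormalBasis (Fin n) 𝕜 F) (l : Fin n → ℝ), ∀ (i : Fin n) (x : A.domain),
      (x : H) ∈ F → inner 𝕜 (v i : H) (A x) = (l i : 𝕜) * inner 𝕜 (v i : H) (x : H) := by
  let B : F →ₗ[𝕜] F :=
    F.orthogonalProjectionOnto.toLinearMap ∘ₗ A.toFun ∘ₗ Submodule.inclusion hF
  have hB : ∀ u x : F, inner 𝕜 u (B x) = inner 𝕜 (u : H) (A (Submodule.inclusion hF x)) :=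
    fun u x => Submodule.inner_orthogonalProjectionOnto_eq_of_mem_left u _
  have hBs : B.IsSymmetric := fun x y => by
    rw [← inner_conj_symm, hB, hB, inner_conj_symm]
    exact hsymm (Submodule.inclusion hF x) (Submodule.inclusion hF y)
  refine ⟨_, hBs.eigenvectorBasis rfl, hBs.eigenvalues rfl, fun i x hx => ?_⟩
  have h1 := hB (hBs.eigenvectorBasis rfl i) ⟨x, hx⟩
  rw [← hBs, hBs.apply_eigenvectorBasis, inner_smul_left, RCLike.conj_ofReal] at h1
  exact h1.symm

open SpectralModel in
lemma exists_probabilityMeasure_of_finite (A : H →ₗ.[𝕜] H)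
    (hsymm : ∀ x y : A.domain, inner 𝕜 (A x) (y : H) = inner 𝕜 (x : H) (A y))
    (g : ℕ → A.domain) (hg : ∀ s : Finset ℕ, ∑ j ∈ s, ‖(g j : H)‖ ^ 2 ≤ 1) (s : Finset ℕ) :
    ∃ P : ProbabilityMeasure SpectralModel,
      (∀ c : ℕ →₀ 𝕜, c.support ⊆ s → ∫ ω, ‖comb 𝕜 c ω‖ ^ 2 ∂(P : Measure SpectralModel) =
        ‖(Finsupp.linearCombination 𝕜 g c : H)‖ ^ 2) ∧
      ∀ c d : ℕ →₀ 𝕜, c.support ⊆ s → d.support ⊆ s →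
        ∫ ω, ‖(param ω : 𝕜) * comb 𝕜 c ω - ((1 - |param ω| : ℝ) : 𝕜) * comb 𝕜 d ω‖ ^ 2
          ∂(P : Measure SpectralModel) ≤
        ‖A (Finsupp.linearCombination 𝕜 g c) - (Finsupp.linearCombination 𝕜 g d : H)‖ ^ 2 := by
  classical
  set F : Submodule 𝕜 H := Submodule.span 𝕜 ((fun j => (g j : H)) '' s) with hFdef
  have : FiniteDimensional 𝕜 F :=
    FiniteDimensional.span_of_finite 𝕜 (s.finite_toSet.image _)
  have hF : F ≤ A.domain := Submodule.span_le.mpr (by rintro _ ⟨j, -, rfl⟩; exact (g j).2)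
  have hgF : ∀ j ∈ s, (g j : H) ∈ F := fun j hj => Submodule.subset_span ⟨j, hj, rfl⟩
  obtain ⟨n, v, l, hv⟩ := exists_orthonormalBasis_compression A hsymm F hF
  have hcF : ∀ c : ℕ →₀ 𝕜, c.support ⊆ s → (Finsupp.linearCombination 𝕜 g c : H) ∈ F := by
    intro c hc
    rw [Finsupp.linearCombination_apply, Finsupp.sum, Submodule.coe_sum]
    exact Submodule.sum_mem _ fun j hj => Submodule.smul_mem _ _ (hgF j (hc hj))
  have hpars : ∀ x ∈ F, ∑ i, ‖inner 𝕜 (v i : H) x‖ ^ 2 = ‖x‖ ^ 2 := fun x hx =>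
    v.sum_sq_norm_inner_right ⟨x, hx⟩
  have hvo : Orthonormal 𝕜 fun i => (v i : H) := v.orthonormal.comp_linearIsometry F.subtypeₗᵢ
  set p : Fin n → ℝ := fun i => ∑ j ∈ s, ‖inner 𝕜 (v i : H) (g j : H)‖ ^ 2 with hp
  have hp0 : ∀ i, 0 ≤ p i := fun i => by positivity
  have hpsum : ∑ i, p i ≤ 1 := by
    rw [Finset.sum_comm, Finset.sum_congr rfl fun j hj => hpars _ (hgF j hj)]
    exact hg s
  -- Dividing by `√(p i)` keeps the coordinates in the unit ball; the weight `p i` undoes it in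
  -- integrals. If `p i = 0`, the inverse is `0` and all the inner products vanish anyway.
  set z : Fin n → ℕ → 𝕜 := fun i j =>
    if j ∈ s then ((√(p i))⁻¹ : ℝ) * inner 𝕜 (v i : H) (g j : H) else 0
  have hz : ∀ i j, ‖z i j‖ ≤ 1 := by
    intro i j
    by_cases hj : j ∈ s
    · simp only [z, if_pos hj, norm_mul, RCLike.norm_ofReal, abs_inv,
        abs_of_nonneg (Real.sqrt_nonneg _)]
      refine inv_mul_le_one_of_le₀ (Real.le_sqrt_of_sq_le ?_) (Real.sqrt_nonneg _)
      exact Finset.single_le_sum (f := fun j => ‖inner 𝕜 (v i : H) (g j : H)‖ ^ 2)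
        (fun j _ => by positivity) hj
    · simp [z, hj]
  have hb : ∀ i, 0 < 1 + |l i| := fun i => by positivity
  have ht : ∀ i, |l i / (1 + |l i|)| ≤ 1 := fun i => by
    rw [abs_div, abs_of_pos (hb i), div_le_one (hb i)]
    linarith
  choose ω hω1 hω2 using fun i => exists_point (l i / (1 + |l i|)) (ht i) (z i) (hz i)
  obtain ⟨ω₀, -, hω0⟩ := exists_point (𝕜 := 𝕜) 0 (by simp) 0 (by simp)
  obtain ⟨P, hP⟩ := exists_probabilityMeasure_integral_eq_sum ω₀ ω p hp0 hpsum
  have hcomb0 : ∀ c : ℕ →₀ 𝕜, comb 𝕜 c ω₀ = 0 := fun c => by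
    simp [comb_apply, hω0, Finsupp.linearCombination_apply]
  have hcomb : ∀ c : ℕ →₀ 𝕜, c.support ⊆ s → ∀ i, comb 𝕜 c (ω i) =
      ((√(p i))⁻¹ : ℝ) * inner 𝕜 (v i : H) (Finsupp.linearCombination 𝕜 g c : H) := by
    intro c hc i
    rw [comb_apply, Finsupp.linearCombination_apply, Finsupp.linearCombination_apply,
      Finsupp.sum, Finsupp.sum, Submodule.coe_sum, inner_sum, Finset.mul_sum]
    refine Finset.sum_congr rfl fun j hj => ?_
    rw [hω2, Submodule.coe_smul, inner_smul_right, smul_eq_mul]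
    simp only [z, if_pos (hc hj)]
    ring
  have hzero : ∀ i, p i = 0 → ∀ c : ℕ →₀ 𝕜, c.support ⊆ s →
      inner 𝕜 (v i : H) (Finsupp.linearCombination 𝕜 g c : H) = 0 := by
    intro i hi c hc
    rw [Finsupp.linearCombination_apply, Finsupp.sum, Submodule.coe_sum, inner_sum]
    refine Finset.sum_eq_zero fun j hj => ?_
    have := (Finset.sum_eq_zero_iff_of_nonneg fun j _ => by positivity).mp hi j (hc hj)
    rw [Submodule.coe_smul, inner_smul_right, norm_eq_zero.mp (pow_eq_zero_iff two_ne_zero |>.mp this),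
      mul_zero]
  have hsq : ∀ i, p i ≠ 0 → ∀ a : 𝕜, p i * ‖(((√(p i))⁻¹ : ℝ) : 𝕜) * a‖ ^ 2 = ‖a‖ ^ 2 := by
    intro i hi a
    rw [norm_mul, RCLike.norm_ofReal, mul_pow, sq_abs, inv_pow, Real.sq_sqrt (hp0 i),
      mul_inv_cancel_left₀ hi]
  refine ⟨P, fun c hc => ?_, fun c d hc hd => ?_⟩
  · rw [← hpars _ (hcF c hc)]
    refine (hP ⟨fun ω => ‖comb 𝕜 c ω‖ ^ 2, by fun_prop⟩ (by simp [hcomb0])).trans ?_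
    refine Finset.sum_congr rfl fun i _ => ?_
    simp only [ContinuousMap.coe_mk, hcomb c hc]
    by_cases hi : p i = 0
    · simp [hi, hzero i hi c hc]
    · exact hsq i hi _
  · refine (hP ⟨fun ω => ‖(param ω : 𝕜) * comb 𝕜 c ω -
      ((1 - |param ω| : ℝ) : 𝕜) * comb 𝕜 d ω‖ ^ 2, by fun_prop⟩ (by simp [hcomb0])).trans_le ?_
    -- Only Bessel's inequality is available, since `A` may map out of `F`.
    refine le_trans ?_ (hvo.sum_inner_products_le (s := Finset.univ) _)
    refine Finset.sum_le_sum fun i _ => ?_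
    simp only [ContinuousMap.coe_mk, hcomb c hc, hcomb d hd, hω1]
    by_cases hi : p i = 0
    · simp only [hi, zero_mul]
      positivity
    · have hrew : ((l i / (1 + |l i|) : ℝ) : 𝕜) * ((((√(p i))⁻¹ : ℝ) : 𝕜) *
            inner 𝕜 (v i : H) (Finsupp.linearCombination 𝕜 g c : H)) -
          ((1 - |l i / (1 + |l i|)| : ℝ) : 𝕜) * ((((√(p i))⁻¹ : ℝ) : 𝕜) *
            inner 𝕜 (v i : H) (Finsupp.linearCombination 𝕜 g d : H)) =
          (((√(p i))⁻¹ : ℝ) : 𝕜) * ((((1 + |l i|)⁻¹ : ℝ) : 𝕜) * inner 𝕜 (v i : H)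
            (A (Finsupp.linearCombination 𝕜 g c) - (Finsupp.linearCombination 𝕜 g d : H))) := by
        have h1 : 1 - |l i / (1 + |l i|)| = (1 + |l i|)⁻¹ := by
          rw [abs_div, abs_of_pos (hb i)]
          have := (hb i).ne'
          field_simp
          ring
        rw [h1, inner_sub_right, hv i _ (hcF c hc), div_eq_mul_inv, RCLike.ofReal_mul]
        ring
      rw [hrew, hsq i hi, norm_mul, RCLike.norm_ofReal, abs_of_pos (inv_pos.mpr (hb i))]
      gcongr
      refine mul_le_of_le_one_left (norm_nonneg _) (inv_le_one_of_one_le₀ ?_)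
      linarith [abs_nonneg (l i)]

end Compression

/-! ### Weak limit of the measures -/

section Limit

variable {𝕜 : Type*} [RCLike 𝕜] {H : Type*} [NormedAddCommGroup H] [InnerProductSpace 𝕜 H]

-- Probability measures on a compact metrizable space are weakly compact, and each relation involves
-- finite supports, so it holds for all large `s`.
open SpectralModel Filter Topology in
lemma exists_probabilityMeasure_spectralModel (A : H →ₗ.[𝕜] H)
    (hsymm : ∀ x y : A.domain, inner 𝕜 (A x) (y : H) = inner 𝕜 (x : H) (A y))
    (g : ℕ → A.domain) (hg : ∀ s : Finset ℕ, ∑ j ∈ s, ‖(g j : H)‖ ^ 2 ≤ 1) :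
    ∃ P : ProbabilityMeasure SpectralModel,
      (∀ c : ℕ →₀ 𝕜, ∫ ω, ‖comb 𝕜 c ω‖ ^ 2 ∂(P : Measure SpectralModel) =
        ‖(Finsupp.linearCombination 𝕜 g c : H)‖ ^ 2) ∧
      ∀ c d : ℕ →₀ 𝕜,
        ∫ ω, ‖(param ω : 𝕜) * comb 𝕜 c ω - ((1 - |param ω| : ℝ) : 𝕜) * comb 𝕜 d ω‖ ^ 2
          ∂(P : Measure SpectralModel) ≤
        ‖A (Finsupp.linearCombination 𝕜 g c) - (Finsupp.linearCombination 𝕜 g d : H)‖ ^ 2 := by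
  choose P hP1 hP2 using exists_probabilityMeasure_of_finite A hsymm g hg
  let u : Ultrafilter (Finset ℕ) := Ultrafilter.of atTop
  have hu : (u : Filter (Finset ℕ)) ≤ atTop := Ultrafilter.of_le atTop
  obtain ⟨μ, -, hμ⟩ := isCompact_univ.ultrafilter_le_nhds (u.map P) (by simp)
  have hlim : ∀ h : C(SpectralModel, ℝ), Tendsto (fun s => ∫ ω, h ω ∂(P s : Measure SpectralModel))
      u (𝓝 (∫ ω, h ω ∂(μ : Measure SpectralModel))) := fun h =>
    ProbabilityMeasure.tendsto_iff_forall_integral_tendsto.mp hμ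
      (BoundedContinuousFunction.mkOfCompact h)
  refine ⟨μ, fun c => ?_, fun c d => ?_⟩
  · refine tendsto_nhds_unique (hlim ⟨fun ω => ‖comb 𝕜 c ω‖ ^ 2, by fun_prop⟩) ?_
    refine tendsto_const_nhds.congr' ?_
    filter_upwards [hu (eventually_ge_atTop c.support)] with s hs
    exact (hP1 s c hs).symm
  · refine le_of_tendsto (hlim ⟨fun ω => ‖(param ω : 𝕜) * comb 𝕜 c ω -
      ((1 - |param ω| : ℝ) : 𝕜) * comb 𝕜 d ω‖ ^ 2, by fun_prop⟩) ?_
    filter_upwards [hu (eventually_ge_atTop c.support), hu (eventually_ge_atTop d.support)]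
      with s hs hs'
    exact hP2 s c d hs hs'

/-- Density in the graph, not merely in the domain, is needed because `A` may be unbounded. The
graph is separable, and rescaling a dense sequence does not change its span. -/
lemma exists_seq_graph_subset_closure [TopologicalSpace.SeparableSpace H] (A : H →ₗ.[𝕜] H) :
    ∃ g : ℕ → A.domain, (∀ s : Finset ℕ, ∑ j ∈ s, ‖(g j : H)‖ ^ 2 ≤ 1) ∧
      ∀ x : A.domain, ((x : H), A x) ∈ closure (Set.range fun c : ℕ →₀ 𝕜 =>
        ((Finsupp.linearCombination 𝕜 g c : H), A (Finsupp.linearCombination 𝕜 g c))) := by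
  have : SecondCountableTopology H := UniformSpace.secondCountable_of_separable H
  have hu := fun n => (LinearPMap.mem_graph_iff' _).mp
    (TopologicalSpace.denseSeq A.graph n).2
  choose y hy using hu
  set r : ℕ → ℝ := fun n => (1 / 2 / 2 ^ n) / (1 + ‖(y n : H)‖)
  have hr : ∀ n, 0 < r n := fun n => by positivity
  refine ⟨fun n => (r n : 𝕜) • y n, fun s => ?_, fun x => ?_⟩
  · refine le_trans (Finset.sum_le_sum fun n _ => ?_)
      (sum_le_hasSum s (fun n _ => by positivity) (hasSum_geometric_two' 1))
    have h1 : ‖(((r n : 𝕜) • y n : A.domain) : H)‖ ≤ 1 / 2 / 2 ^ n := by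
      rw [Submodule.coe_smul, norm_smul, RCLike.norm_ofReal, abs_of_pos (hr n), div_mul_eq_mul_div]
      refine div_le_of_le_mul₀ (by positivity) (by positivity) ?_
      gcongr
      linarith
    have h2 : (1 : ℝ) / 2 / 2 ^ n ≤ 1 := by
      rw [div_le_one (by positivity)]
      linarith [one_le_pow₀ (n := n) (one_le_two (α := ℝ))]
    calc _ ≤ ‖(((r n : 𝕜) • y n : A.domain) : H)‖ :=
          pow_le_of_le_one (norm_nonneg _) (h1.trans h2) two_ne_zero
      _ ≤ _ := h1
  · have hx : (⟨((x : H), A x), A.mem_graph x⟩ : A.graph) ∈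
        closure (Set.range (TopologicalSpace.denseSeq A.graph)) :=
      TopologicalSpace.denseRange_denseSeq _ _
    have := map_mem_closure (t := Set.range fun c : ℕ →₀ 𝕜 =>
      ((Finsupp.linearCombination 𝕜 (fun n => (r n : 𝕜) • y n) c : H),
        A (Finsupp.linearCombination 𝕜 (fun n => (r n : 𝕜) • y n) c)))
      continuous_subtype_val hx ?_
    · exact this
    · rintro _ ⟨n, rfl⟩
      refine ⟨Finsupp.single n ((r n : 𝕜)⁻¹), ?_⟩
      have hne : (r n : 𝕜) ≠ 0 := RCLike.ofReal_ne_zero.mpr (hr n).ne'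
      simp only [Finsupp.linearCombination_single, smul_smul, inv_mul_cancel₀ hne, one_smul]
      exact hy n

end Limit

/-! ### Bounded multipliers and the isometry -/

section BoundedMultiplication

variable {𝕜 : Type*} [RCLike 𝕜] {Ω : Type*} [MeasurableSpace Ω] {μ : Measure Ω}

lemma exists_continuousLinearMap_mul {φ : Ω → ℝ} (hφ : Measurable φ) (hb : ∀ ω, |φ ω| ≤ 1) :
    ∃ M : Lp 𝕜 2 μ →L[𝕜] Lp 𝕜 2 μ, ∀ f, M f =ᵐ[μ] fun ω => (φ ω : 𝕜) * f ω := by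
  have hle : ∀ (f : Lp 𝕜 2 μ) ω, ‖(φ ω : 𝕜) * f ω‖ ≤ ‖f ω‖ := fun f ω => by
    rw [norm_mul, RCLike.norm_ofReal]
    exact mul_le_of_le_one_left (norm_nonneg _) (hb ω)
  have hdom : ∀ f, f ∈ (mulOperator 𝕜 μ φ).domain := fun f =>
    (Lp.memLp f).of_le ((RCLike.measurable_ofReal.comp hφ).aestronglyMeasurable.mul
      (Lp.memLp f).aestronglyMeasurable) (.of_forall (hle f))
  let M : Lp 𝕜 2 μ →ₗ[𝕜] Lp 𝕜 2 μ :=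
    (mulOperator 𝕜 μ φ).toFun ∘ₗ LinearMap.id.codRestrict _ hdom
  have hM : ∀ f, M f =ᵐ[μ] fun ω => (φ ω : 𝕜) * f ω := fun f => coeFn_mulOperator ⟨f, hdom f⟩
  refine ⟨M.mkContinuous 1 fun f => ?_, hM⟩
  rw [one_mul]
  refine Lp.norm_le_norm_of_ae_le ?_
  filter_upwards [hM f] with ω hω
  rw [hω]
  exact hle f ω

lemma integral_norm_sq_eq_norm_sq_L2 (f : Lp 𝕜 2 μ) : ∫ ω, ‖f ω‖ ^ 2 ∂μ = ‖f‖ ^ 2 := by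
  refine RCLike.ofReal_injective (K := 𝕜) ?_
  rw [RCLike.ofReal_pow, ← inner_self_eq_norm_sq_to_K, L2.inner_def, ← integral_ofReal]
  simp only [inner_self_eq_norm_sq_to_K, RCLike.ofReal_pow]

end BoundedMultiplication

section Representation

variable {𝕜 : Type*} [RCLike 𝕜] {H : Type*} [NormedAddCommGroup H] [InnerProductSpace 𝕜 H]

lemma norm_sq_toLp_continuousMap {Ω : Type*} [TopologicalSpace Ω] [CompactSpace Ω]
    [MeasurableSpace Ω] [BorelSpace Ω] (μ : Measure Ω) [IsFiniteMeasure μ] (f : C(Ω, 𝕜)) :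
    ‖ContinuousMap.toLp 2 μ 𝕜 f‖ ^ 2 = ∫ ω, ‖f ω‖ ^ 2 ∂μ := by
  rw [← integral_norm_sq_eq_norm_sq_L2]
  refine integral_congr_ae ?_
  filter_upwards [ContinuousMap.coeFn_toLp (𝕜 := 𝕜) (p := 2) μ f] with ω hω
  rw [hω]

lemma exists_linearIsometry_of_norm_eq {E G : Type*} [AddCommGroup E] [Module 𝕜 E]
    [NormedAddCommGroup G] [NormedSpace 𝕜 G] [CompleteSpace G] (e : E →ₗ[𝕜] H) (f : E →ₗ[𝕜] G)
    (he : DenseRange e) (h : ∀ c, ‖f c‖ = ‖e c‖) :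
    ∃ U : H →ₗᵢ[𝕜] G, ∀ c, U (e c) = f c := by
  have hU : ∀ c, f.extendOfNorm e (e c) = f c :=
    LinearMap.extendOfNorm_eq he ⟨1, fun c => by rw [one_mul, h]⟩
  refine ⟨⟨(f.extendOfNorm e).toLinearMap, fun x => ?_⟩, hU⟩
  refine he.induction_on (p := fun x => ‖f.extendOfNorm e x‖ = ‖x‖) x
    (isClosed_eq (by fun_prop) (by fun_prop)) fun c => ?_
  rw [hU, h]

open SpectralModel in
lemma exists_spectral_representation [TopologicalSpace.SeparableSpace H] (A : H →ₗ.[𝕜] H)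
    (hdense : Dense (A.domain : Set H))
    (hsymm : ∀ x y : A.domain, inner 𝕜 (A x) (y : H) = inner 𝕜 (x : H) (A y)) :
    ∃ (μ : ProbabilityMeasure SpectralModel)
      (U : H →ₗᵢ[𝕜] Lp 𝕜 2 (μ : Measure SpectralModel)), ∀ x : A.domain,
      (fun ω => (param ω : 𝕜) * U (x : H) ω) =ᵐ[(μ : Measure SpectralModel)]
        fun ω => ((1 - |param ω| : ℝ) : 𝕜) * U (A x) ω := by
  obtain ⟨g, hg, hgraph⟩ := exists_seq_graph_subset_closure A
  obtain ⟨P, hP1, hP2⟩ := exists_probabilityMeasure_spectralModel A hsymm g hg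
  let μ : Measure SpectralModel := P
  let e : (ℕ →₀ 𝕜) →ₗ[𝕜] H := A.domain.subtype ∘ₗ Finsupp.linearCombination 𝕜 g
  let f : (ℕ →₀ 𝕜) →ₗ[𝕜] Lp 𝕜 2 μ := (ContinuousMap.toLp 2 μ 𝕜).toLinearMap ∘ₗ comb 𝕜
  have he : DenseRange e := by
    refine Dense.of_closure (hdense.mono fun x hx => ?_)
    refine map_mem_closure continuous_fst (hgraph ⟨x, hx⟩) ?_
    rintro _ ⟨c, rfl⟩
    exact ⟨c, rfl⟩
  have hnorm : ∀ c, ‖f c‖ = ‖e c‖ := fun c => by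
    rw [← sq_eq_sq₀ (norm_nonneg _) (norm_nonneg _)]
    exact (norm_sq_toLp_continuousMap μ _).trans (hP1 c)
  obtain ⟨U, hU⟩ := exists_linearIsometry_of_norm_eq e f he hnorm
  have hf : ∀ c, f c =ᵐ[μ] comb 𝕜 c := fun c =>
    ContinuousMap.coeFn_toLp (𝕜 := 𝕜) (p := 2) μ (comb 𝕜 c)
  obtain ⟨M, hM⟩ := exists_continuousLinearMap_mul (𝕜 := 𝕜) (μ := μ) (φ := param)
    param.continuous.measurable abs_param_le
  obtain ⟨N, hN⟩ := exists_continuousLinearMap_mul (𝕜 := 𝕜) (μ := μ) (φ := fun ω => 1 - |param ω|)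
    (measurable_const.sub param.continuous.measurable.abs) fun ω => by
      rw [abs_le]
      constructor <;> linarith [abs_param_le ω, abs_nonneg (param ω)]
  have hbound : ∀ c d, ‖M (f c) - N (f d)‖ ≤ ‖A (Finsupp.linearCombination 𝕜 g c) - e d‖ := by
    intro c d
    refine (sq_le_sq₀ (norm_nonneg _) (norm_nonneg _)).mp (le_trans (le_of_eq ?_) (hP2 c d))
    rw [← integral_norm_sq_eq_norm_sq_L2]
    refine integral_congr_ae ?_
    filter_upwards [Lp.coeFn_sub (M (f c)) (N (f d)), hM (f c), hN (f d), hf c, hf d]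
      with ω h1 h2 h3 h4 h5
    rw [h1, Pi.sub_apply, h2, h3, h4, h5]
  -- Density replaces `e d` by any `y`, so that `y = A g_c` makes the right side zero.
  have hrange : ∀ c y, ‖M (U (e c)) - N (U y)‖ ≤ ‖A (Finsupp.linearCombination 𝕜 g c) - y‖ := by
    intro c y
    refine he.induction_on (p := fun y => ‖M (U (e c)) - N (U y)‖ ≤
      ‖A (Finsupp.linearCombination 𝕜 g c) - y‖) y
      (isClosed_le (by fun_prop) (by fun_prop)) fun d => ?_
    rw [hU, hU]
    exact hbound c d
  refine ⟨P, U, fun x => ?_⟩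
  have hx : M (U (x : H)) = N (U (A x)) := by
    have hcl : IsClosed {p : H × H | M (U p.1) = N (U p.2)} :=
      isClosed_eq (by fun_prop) (by fun_prop)
    refine closure_minimal ?_ hcl (hgraph x)
    rintro _ ⟨c, rfl⟩
    have := hrange c (A (Finsupp.linearCombination 𝕜 g c))
    rw [sub_self, norm_zero, norm_le_zero_iff] at this
    exact sub_eq_zero.mp this
  refine (hM _).symm.trans ?_
  rw [hx]
  exact hN _

end Representation

/-! ### Removing the points at infinity -/

open SpectralModel in
theorem mainTheorem1 {𝕜 : Type*} [RCLike 𝕜] {H : Type*} [NormedAddCommGroup H]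
    [InnerProductSpace 𝕜 H] [CompleteSpace H] [TopologicalSpace.SeparableSpace H]
    (hH : ¬ FiniteDimensional 𝕜 H) (A : H →ₗ.[𝕜] H) (hdense : Dense (A.domain : Set H))
    (hsymm : ∀ x y : A.domain, inner 𝕜 (A x) (y : H) = inner 𝕜 (x : H) (A y)) :
    ∃ (Ω : Type) (_ : MetricSpace Ω) (_ : CompactSpace Ω) (_ : MeasurableSpace Ω)
      (_ : BorelSpace Ω) (μ : Measure Ω) (_ : IsProbabilityMeasure μ) (m : Ω → ℝ)
      (U : H →ₗᵢ[𝕜] Lp 𝕜 2 μ),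
      Measurable m ∧
      Dense ((mulOperator 𝕜 μ m).domain : Set (Lp 𝕜 2 μ)) ∧
      IsSelfAdjoint (mulOperator 𝕜 μ m) ∧
      ∀ x : A.domain, ∃ hx : U (x : H) ∈ (mulOperator 𝕜 μ m).domain,
        mulOperator 𝕜 μ m ⟨U (x : H), hx⟩ = U (A x) := by
  obtain ⟨P, U, hU⟩ := exists_spectral_representation A hdense hsymm
  let μ : Measure SpectralModel := P
  have hp : Measurable (param : SpectralModel → ℝ) := param.continuous.measurable
  have hm : Measurable fun ω : SpectralModel => param ω / (1 - |param ω|) :=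
    hp.div (measurable_const.sub hp.abs)
  let S : Set SpectralModel := {ω | |param ω| = 1}
  have hS : MeasurableSet S := measurableSet_eq_fun hp.abs measurable_const
  obtain ⟨M, hM⟩ := exists_continuousLinearMap_mul (𝕜 := 𝕜) (μ := μ) (φ := S.indicator 1)
    (measurable_one.indicator hS) fun ω => by
      by_cases hω : ω ∈ S <;> simp [hω]
  -- On `S` the relation reads `t U x = 0` with `t = ±1`, for `x` in the domain. By density `U x`
  -- vanishes on `S` for every `x`, in particular for `A x`.
  have hM0 : ∀ x : H, M (U x) = 0 := by
    intro x
    have hcl : IsClosed {x : H | M (U x) = 0} := isClosed_eq (by fun_prop) (by fun_prop)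
    refine closure_minimal (fun y hy => ?_) hcl (hdense x)
    refine Lp.eq_zero_iff_ae_eq_zero.mpr ?_
    filter_upwards [hM (U y), hU ⟨y, hy⟩] with ω h1 h2
    rw [h1, Pi.zero_apply]
    by_cases hω : ω ∈ S
    · have hω' : |param ω| = 1 := hω
      have hne : (param ω : 𝕜) ≠ 0 := RCLike.ofReal_ne_zero.mpr fun h => by simp [h] at hω'
      rw [hω', sub_self, RCLike.ofReal_zero, zero_mul] at h2
      rw [(mul_eq_zero.mp h2).resolve_left hne, mul_zero]
    · simp [hω]
  have hmul : ∀ x : A.domain,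
      (fun ω => U (A x) ω) =ᵐ[μ] fun ω => ((param ω / (1 - |param ω|) : ℝ) : 𝕜) * U (x : H) ω := by
    intro x
    have h0 := (hM (U (A x))).symm
    rw [hM0] at h0
    filter_upwards [h0, hU x, Lp.coeFn_zero 𝕜 2 μ] with ω h1 h2 h3
    rw [h3, Pi.zero_apply] at h1
    -- Here division by zero makes `m` equal to `0`, consistent with `U (A x) = 0`.
    by_cases hω : |param ω| = 1
    · rw [Set.indicator_of_mem (by exact hω)] at h1
      simpa [hω] using h1
    · have hne : ((1 - |param ω| : ℝ) : 𝕜) ≠ 0 :=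
        RCLike.ofReal_ne_zero.mpr (sub_ne_zero.mpr (Ne.symm hω))
      rw [RCLike.ofReal_div, div_mul_eq_mul_div, h2, mul_div_cancel_left₀ _ hne]
  refine ⟨SpectralModel, TopologicalSpace.metrizableSpaceMetric _, inferInstance, inferInstance,
    inferInstance, μ, inferInstance, _, U, hm, dense_mulOperator_domain hm,
    isSelfAdjoint_mulOperator hm, fun x => ⟨(Lp.memLp (U (A x))).ae_eq (hmul x), ?_⟩⟩
  exact Lp.ext ((coeFn_mulOperator _).trans (hmul x).symm)
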